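/- Let $K$ be a field of characteristic $0$ and let $G$ be a finite directed graph: a finite vertex set $V$ with $n$ elements and an edge set $E\subseteq V\times V$. An edge $e=(v,v')$ has origin $\alpha(e)=v$ and end $\omega(e)=v'$. A linear extension of $G$ is a total order on $V$, written as a word $w=w_1\cdots w_n$ listing $V$ in increasing order, such that $\alpha(e)\le_w\omega(e)$ for every $e\in E$. In the field of rational functions $K(x_v : v\in V)$ put $$\Psi(G)=\sum_{w}\frac{1}{(x_{w_1}-x_{w_2})\cdots(x_{w_{n-1}}-x_{w_n})},\qquad N(G)=\Psi(G)\cdot\prod_{e\in E}\bigl(x_{\alpha(e)}-x_{\omega(e)}\bigr),$$ where the sum runs over all linear extensions $w$ of $G$. Each edge $e$ consists of two darts: its first dart, with extremity $\alpha(e)$, and its second dart, with extremity $\omega(e)$. A rooted map $M$ with underlying graph $G$ is given when $G$ is connected (forgetting orientations, so $V\neq\emptyset$); it consists of a vertex $\star$, taken as the extremity of an additional external dart $h_0$ belonging to no edge, and a permutation $\sigma$ of the set of all darts, $h_0$ included, whose orbits are exactly the sets of darts with the same extremity. A spanning tree of $G$ is a set $T\subseteq E$ such that $(V,T)$ is connected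 and has cyclomatic number $|T|-|V|+1=0$. The tour of $T$ is the sequence of darts that starts at $h_0$ and in which a dart $h$ is followed by $\sigma(h')$, where $h'$ is the other dart of the edge of $h$ if that edge belongs to $T$, and $h'=h$ otherwise. The spanning tree $T$ is good if, for every edge $e\in E\setminus T$, the first dart of $e$ appears in the tour of $T$ before its second dart. Theorem. For every rooted map $M$ with underlying graph $G$, $N(G)$ is a polynomial, given by $$N(G)=\sum_{\substack{T\text{ good spanning}\\ \text{tree of }M}}\ \prod_{e\in E\setminus T}\bigl(x_{\alpha(e)}-x_{\omega(e)}\bigr).$$ In particular, the right-hand side takes the same value for any two rooted maps with the same underlying graph $G$. -/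

import Mathlib

/-!
Finite directed graphs are Mathlib's `Digraph V` on a finite type `V`: a set of ordered pairs of
vertices (loops and pairs of opposite edges are allowed, parallel edges are not). The edge `e` has
origin `e.1` and end `e.2`. Subgraphs `T ≤ G` have the same vertex set as `G`.
-/

namespace Digraph

open Classical in
/-- The set of edges, as ordered pairs of vertices. -/
noncomputable def edgeFinset {V : Type*} [Fintype V] (G : Digraph V) : Finset (V × V) :=
  Finset.univ.filter fun e => G.Adj e.1 e.2

/-- Connectedness, forgetting the orientation of the edges; in particular `V` is nonempty. -/
def IsConnected {V : Type*} (G : Digraph V) : Prop :=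
  G.toSimpleGraphInclusive.Connected

/-- The cyclomatic number: edges minus vertices plus connected components. -/
noncomputable def cyclomaticNumber {V : Type*} [Fintype V] (G : Digraph V) : ℤ :=
  (G.edgeFinset.card : ℤ) - (Fintype.card V : ℤ)
    + (Nat.card G.toSimpleGraphInclusive.ConnectedComponent : ℤ)

/-- A forest is a graph without cycles, i.e. with cyclomatic number zero. -/
def IsForest {V : Type*} [Fintype V] (G : Digraph V) : Prop :=
  G.cyclomaticNumber = 0

/-- A tree is a connected forest (with no condition on the orientation of its edges). -/
def IsTree {V : Type*} [Fintype V] (G : Digraph V) : Prop :=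
  G.IsConnected ∧ G.IsForest

/-- A spanning tree of `G`: a subgraph on the same vertex set that is a tree. -/
def IsSpanningTree {V : Type*} [Fintype V] (G T : Digraph V) : Prop :=
  T ≤ G ∧ T.IsTree

/-! ### Linear extensions and rational functions -/

open Classical in
/-- The linear extensions of `G`. A total order on `V` is written as the word `w 0, w 1, …`
enumerating the vertices in increasing order, so `w.symm v` is the position of `v`. -/
noncomputable def linearExtensions {V : Type*} [Fintype V] (G : Digraph V) :
    Finset (Fin (Fintype.card V) ≃ V) :=
  Finset.univ.filter fun w => ∀ v v' : V, G.Adj v v' → w.symm v ≤ w.symm v'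

/-- The variable `x_v`, in the field `K(x_v : v ∈ V)` of rational functions. -/
noncomputable def ratVar (K : Type*) [Field K] {V : Type*} (v : V) :
    FractionRing (MvPolynomial V K) :=
  algebraMap (MvPolynomial V K) (FractionRing (MvPolynomial V K)) (MvPolynomial.X v)

/-- `Ψ(G)`: the sum over the linear extensions `w` of
`1 / ((x_{w_1} - x_{w_2}) ⋯ (x_{w_{n-1}} - x_{w_n}))`. -/
noncomputable def Psi (K : Type*) [Field K] {V : Type*} [Fintype V] (G : Digraph V) :
    FractionRing (MvPolynomial V K) :=
  ∑ w ∈ G.linearExtensions,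
    1 / ∏ i : Fin (Fintype.card V - 1),
      (ratVar K (w ⟨i.1, by have := i.2; omega⟩) - ratVar K (w ⟨i.1 + 1, by have := i.2; omega⟩))

/-- `N(G)`: the product of `Ψ(G)` with all `x_{α(e)} - x_{ω(e)}`, `e` an edge of `G`. -/
noncomputable def numerator (K : Type*) [Field K] {V : Type*} [Fintype V] (G : Digraph V) :
    FractionRing (MvPolynomial V K) :=
  G.Psi K * ∏ e ∈ G.edgeFinset, (ratVar K e.1 - ratVar K e.2)

/-! ### Rooted maps -/

/-- The edges of `G`, as a type. -/
abbrev Edge {V : Type*} (G : Digraph V) : Type _ := {e : V × V // G.Adj e.1 e.2}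

/-- The darts (half-edges) belonging to edges: `Sum.inl e` is the first dart of `e` (at its
origin), `Sum.inr e` is its second dart (at its end). -/
abbrev Dart {V : Type*} (G : Digraph V) : Type _ := G.Edge ⊕ G.Edge

/-- The edge to which a dart belongs. -/
def Dart.edge {V : Type*} {G : Digraph V} : G.Dart → G.Edge :=
  Sum.elim id id

/-- The extremity of a dart. -/
def Dart.extremity {V : Type*} {G : Digraph V} : G.Dart → V :=
  Sum.elim (fun e => e.1.1) (fun e => e.1.2)

/-- A rooted combinatorial map with underlying graph `G`. The external dart is `none`; `star` is its
extremity. The orbits of the permutation `next` of all darts (including the external one) are the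
sets of darts with the same extremity, so `next` is a cyclic order around each vertex. -/
structure RootedMap {V : Type*} (G : Digraph V) where
  connected : G.IsConnected
  star : V
  next : Equiv.Perm (Option G.Dart)
  sameCycle_iff : ∀ h h' : Option G.Dart,
    next.SameCycle h h' ↔ h.elim star Dart.extremity = h'.elim star Dart.extremity

namespace RootedMap

open Classical in
/-- If `h` belongs to an edge of `T`, the other dart of that edge; otherwise `h` itself. -/
noncomputable def cross {V : Type*} {G : Digraph V} (T : Digraph V) :
    Option G.Dart → Option G.Dart
  | none => none
  | some h =>
      if T.Adj (Dart.edge h).1.1 (Dart.edge h).1.2 then some h.swap else some h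

/-- One step of the tour of `T`: follow the edge of the current dart if it is in `T`, then turn to
the next dart around the vertex reached. -/
noncomputable def tourStep {V : Type*} {G : Digraph V} (M : G.RootedMap) (T : Digraph V)
    (h : Option G.Dart) : Option G.Dart :=
  M.next (cross T h)

/-- The dart met after `n` steps of the tour of `T` beginning at the external dart. -/
noncomputable def tour {V : Type*} {G : Digraph V} (M : G.RootedMap) (T : Digraph V) (n : ℕ) :
    Option G.Dart :=
  (M.tourStep T)^[n] none

/-- `h` appears before `h'` in the tour of `T`: at some time `h` has been met and `h'` has not. -/
def TourBefore {V : Type*} {G : Digraph V} (M : G.RootedMap) (T : Digraph V)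
    (h h' : G.Dart) : Prop :=
  ∃ n : ℕ, M.tour T n = some h ∧ ∀ m ≤ n, M.tour T m ≠ some h'

/-- A spanning tree is good if the first dart of every edge outside it appears in its tour before
the second dart. -/
def IsGood {V : Type*} [Fintype V] {G : Digraph V} (M : G.RootedMap) (T : Digraph V) : Prop :=
  G.IsSpanningTree T ∧
    ∀ e : G.Edge, ¬ T.Adj e.1.1 e.1.2 → M.TourBefore T (Sum.inl e) (Sum.inr e)

open Classical in
/-- The set of good spanning trees. -/
noncomputable def goodTrees {V : Type*} [Fintype V] {G : Digraph V} (M : G.RootedMap) :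
    Finset (Digraph V) :=
  Finset.univ.filter fun T => M.IsGood T

end RootedMap

end Digraph

namespace Digraph

/-! ### Words and rational functions -/

section Words

variable {V L : Type*} [Field L]

/-! The tour is followed dart by dart, and each edge is put in or out of the tree when it is first
met. `TourStage` records the edges `F` kept so far, the set `D` of decided edges and the set `A` of
kept edges reoriented towards the root. By `goodTreeSum_eq`, the good trees compatible with these
choices contribute Ψ(`stageGraph D A`) · ∏_A (x_c - x_p) · ∏_{E∖F} (x_α - x_ω). With no decision
made, this is the theorem.

Let `e` be undecided at the current dart `h`. If its other end is already visited, that end is an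
ancestor in `A`, and keeping `e` would close a cycle. When `h` is the first dart, `e` is deleted and
Ψ does not change, since `e` follows by transitivity. When `h` is the second dart, deletion is not
good, and both sides vanish: `e` and `A` form a directed cycle, or `e` is a loop. If the other end
`c` is new and `p` is the end of `h`, a second dart forces `e` to be kept, already oriented towards
the root. A first dart allows both choices, which match Ψ(H) = Ψ(H + (p,c)) + Ψ(H + (c,p)), with H
the stage graph without `e`; the sign comes from x_c - x_p against x_p - x_c.

When no dart is pending, either some vertex is unvisited, no tree remains and Ψ vanishes by
`wordSum_union_eq_zero` (disconnected graph), or exactly one tree remains and `wordSum_mul_prod`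
evaluates Ψ on a tree. -/

/-- The product of the inverses of the differences `x_b - x_a` of successive letters `a`, `b` of a
word, the value `y` being put in front of the word. -/
def pathWeight (x : V → L) : L → List V → L
  | _, [] => 1
  | y, a :: l => (x a - y)⁻¹ * pathWeight x (x a) l

/-- The product of the inverses of the differences `x_b - x_a` of successive letters of a word. -/
def wordWeight (x : V → L) : List V → L
  | [] => 1
  | a :: l => pathWeight x (x a) l

theorem wordWeight_ofFn (x : V → L) {k : ℕ} (g : Fin (k + 1) → V) :
    wordWeight x (List.ofFn g) = ∏ i : Fin k, (x (g i.succ) - x (g i.castSucc))⁻¹ := by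
  induction k with
  | zero => simp [wordWeight, pathWeight]
  | succ k ih =>
    have := ih (fun i => g i.succ)
    rw [List.ofFn_succ] at this
    rw [Fin.prod_univ_succ, List.ofFn_succ, List.ofFn_succ, wordWeight, pathWeight]
    rw [wordWeight] at this
    rw [this]
    rfl

open Classical in
/-- The words listing a set of vertices in decreasing order, for the total orders on this set that
are compatible with `H`. -/
noncomputable def descendingWords (H : Digraph V) (S : Finset V) : Finset (List V) :=
  (⟨S.val.lists, Multiset.lists_nodup_finset S⟩ : Finset (List V)).filter
    fun l => l.Pairwise fun a b => ¬ H.Adj a b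

theorem mem_descendingWords {H : Digraph V} {S : Finset V} {l : List V} :
    l ∈ H.descendingWords S ↔
      l.Nodup ∧ (∀ a, a ∈ l ↔ a ∈ S) ∧ l.Pairwise fun a b => ¬ H.Adj a b := by
  classical
  have key : S.val = (l : Multiset V) ↔ l.Nodup ∧ ∀ a, a ∈ l ↔ a ∈ S := by
    constructor
    · intro h
      have h1 := S.nodup
      rw [h] at h1
      exact ⟨h1, fun a => by rw [← Finset.mem_val, h]; rfl⟩
    · rintro ⟨h1, h2⟩
      exact (Multiset.Nodup.ext S.nodup (Multiset.coe_nodup.2 h1)).2 fun a => (h2 a).symm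
  rw [descendingWords, Finset.mem_filter, ← and_assoc, ← key]
  exact and_congr_left fun _ => Multiset.mem_lists_iff _ _

open Classical in
/-- The vertices of `S` with no edge of `H` towards another vertex of `S`. -/
noncomputable def maximalIn (H : Digraph V) (S : Finset V) : Finset V :=
  S.filter fun m => ∀ b ∈ S, b ≠ m → ¬ H.Adj m b

theorem mem_maximalIn {H : Digraph V} {S : Finset V} {m : V} :
    m ∈ H.maximalIn S ↔ m ∈ S ∧ ∀ b ∈ S, b ≠ m → ¬ H.Adj m b := by
  simp [maximalIn]

/-- The sum of the weights of the decreasing words on `S`, preceded by the value `y`. -/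
noncomputable def pathSum (x : V → L) (H : Digraph V) (S : Finset V) (y : L) : L :=
  ∑ l ∈ H.descendingWords S, pathWeight x y l

/-- The sum of the weights of the decreasing words on `S`. -/
noncomputable def wordSum (x : V → L) (H : Digraph V) (S : Finset V) : L :=
  ∑ l ∈ H.descendingWords S, wordWeight x l

/-- Words are read from the largest vertex down, so that recursions peel off a maximal vertex;
reversal only reorders the factors. -/
theorem wordWeight_ofFn_rev (x : V → L) {n : ℕ} (w : Fin n → V) :
    1 / ∏ i : Fin (n - 1),
      (x (w ⟨i.1, by have := i.2; omega⟩) - x (w ⟨i.1 + 1, by have := i.2; omega⟩)) =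
      wordWeight x (List.ofFn fun i => w i.rev) := by
  cases n with
  | zero => simp [wordWeight]
  | succ k =>
    rw [wordWeight_ofFn, Finset.prod_inv_distrib, one_div]
    congr 1
    refine Fintype.prod_equiv Fin.revPerm _ _ fun i => ?_
    congr 3
    · ext; simp [Fin.val_rev]; omega
    · ext; simp [Fin.val_rev]; omega

variable {x : V → L} {H : Digraph V} {S A B : Finset V}

theorem pathSum_empty (y : L) : pathSum x H ∅ y = 1 := by
  have : H.descendingWords ∅ = {[]} := by
    ext l
    rw [mem_descendingWords, Finset.mem_singleton]
    constructor
    · rintro ⟨-, h, -⟩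
      exact List.eq_nil_iff_forall_not_mem.2 fun a ha => by simpa using (h a).1 ha
    · rintro rfl
      simp
  simp [pathSum, this, pathWeight]

theorem descendingWords_congr {H' : Digraph V} (h : ∀ a ∈ S, ∀ b ∈ S, H.Adj a b ↔ H'.Adj a b) :
    H.descendingWords S = H'.descendingWords S := by
  ext l
  rw [mem_descendingWords, mem_descendingWords]
  refine and_congr_right fun _ => and_congr_right fun hl => ?_
  exact ⟨fun hp => hp.imp_of_mem fun ha hb h' => (h _ ((hl _).1 ha) _ ((hl _).1 hb)).not.1 h',
    fun hp => hp.imp_of_mem fun ha hb h' => (h _ ((hl _).1 ha) _ ((hl _).1 hb)).not.2 h'⟩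

variable [DecidableEq V]

theorem sum_descendingWords (f : List V → L) (hS : S.Nonempty) :
    ∑ l ∈ H.descendingWords S, f l =
      ∑ m ∈ H.maximalIn S, ∑ l ∈ H.descendingWords (S.erase m), f (m :: l) := by
  rw [Finset.sum_sigma']
  symm
  refine Finset.sum_nbij (fun p => p.1 :: p.2) ?_ ?_ ?_ fun _ _ => rfl
  · rintro ⟨m, l⟩ h
    simp only [Finset.mem_sigma, mem_maximalIn, mem_descendingWords, Finset.mem_erase] at h ⊢
    obtain ⟨⟨hm, hm'⟩, hl, hl', hp⟩ := h
    refine ⟨List.nodup_cons.2 ⟨fun h => ((hl' m).1 h).1 rfl, hl⟩, fun a => ?_,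
      List.pairwise_cons.2 ⟨fun b hb => ?_, hp⟩⟩
    · rw [List.mem_cons, hl']
      by_cases h : a = m
      · simp [h, hm]
      · simp [h]
    · exact hm' b ((hl' b).1 hb).2 ((hl' b).1 hb).1
  · rintro ⟨m, l⟩ _ ⟨m', l'⟩ _ h
    obtain ⟨rfl, rfl⟩ := List.cons.inj h
    rfl
  · intro l hl
    rw [Finset.mem_coe, mem_descendingWords] at hl
    obtain ⟨hl, hl', hp⟩ := hl
    cases l with
    | nil =>
      obtain ⟨a, ha⟩ := hS
      simpa using (hl' a).2 ha
    | cons m l =>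
      rw [List.nodup_cons] at hl
      rw [List.pairwise_cons] at hp
      refine ⟨⟨m, l⟩, ?_, rfl⟩
      simp only [Finset.coe_sigma, Set.mem_sigma_iff, Finset.mem_coe, mem_maximalIn,
        mem_descendingWords, Finset.mem_erase]
      refine ⟨⟨(hl' m).1 (by simp), fun b hb hne => hp.1 b ?_⟩, hl.2, fun a => ?_, hp.2⟩
      · simpa [hne] using (hl' b).2 hb
      · rw [← hl' a, List.mem_cons]
        by_cases h : a = m
        · simp [h, hl.1]
        · simp [h]

theorem pathSum_eq (hS : S.Nonempty) (y : L) :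
    pathSum x H S y = ∑ m ∈ H.maximalIn S, (x m - y)⁻¹ * pathSum x H (S.erase m) (x m) := by
  rw [pathSum, sum_descendingWords _ hS]
  exact Finset.sum_congr rfl fun m _ => by rw [pathSum, Finset.mul_sum]; rfl

theorem wordSum_eq (hS : S.Nonempty) :
    wordSum x H S = ∑ m ∈ H.maximalIn S, pathSum x H (S.erase m) (x m) := by
  rw [wordSum, sum_descendingWords _ hS]
  exact Finset.sum_congr rfl fun m _ => rfl

theorem pathSum_singleton (a : V) (y : L) : pathSum x H {a} y = (x a - y)⁻¹ := by
  have : H.maximalIn {a} = {a} := by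
    ext b
    simp +contextual [mem_maximalIn]
  rw [pathSum_eq (by simp), this]
  simp [pathSum_empty]

theorem wordSum_singleton (a : V) : wordSum x H {a} = 1 := by
  have : H.maximalIn {a} = {a} := by
    ext b
    simp +contextual [mem_maximalIn]
  rw [wordSum_eq (by simp), this]
  simp [pathSum_empty]

/-! ### Disconnected graphs: shuffles of words -/

theorem maximalIn_union (hAB : ∀ a ∈ A, ∀ b ∈ B, ¬ H.Adj a b ∧ ¬ H.Adj b a) :
    H.maximalIn (A ∪ B) = H.maximalIn A ∪ H.maximalIn B := by
  ext m
  simp only [mem_maximalIn, Finset.mem_union]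
  constructor
  · rintro ⟨h | h, h'⟩
    · exact .inl ⟨h, fun b hb => h' b (.inl hb)⟩
    · exact .inr ⟨h, fun b hb => h' b (.inr hb)⟩
  · rintro (⟨h, h'⟩ | ⟨h, h'⟩)
    · exact ⟨.inl h, fun b hb => hb.elim (h' b) fun hb _ => (hAB m h b hb).1⟩
    · exact ⟨.inr h, fun b hb => hb.elim (fun hb _ => (hAB b hb m h).2) (h' b)⟩

theorem sum_maximalIn_union (f : Finset V → V → L) (hd : Disjoint A B)
    (hAB : ∀ a ∈ A, ∀ b ∈ B, ¬ H.Adj a b ∧ ¬ H.Adj b a) :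
    ∑ m ∈ H.maximalIn (A ∪ B), f ((A ∪ B).erase m) m =
      ∑ a ∈ H.maximalIn A, f (A.erase a ∪ B) a + ∑ b ∈ H.maximalIn B, f (A ∪ B.erase b) b := by
  have hA : ∀ a ∈ H.maximalIn A, a ∈ A := fun a ha => (mem_maximalIn.1 ha).1
  have hB : ∀ a ∈ H.maximalIn B, a ∈ B := fun a ha => (mem_maximalIn.1 ha).1
  rw [maximalIn_union hAB, Finset.sum_union]
  · congr 1
    · refine Finset.sum_congr rfl fun a ha => ?_
      rw [Finset.erase_union_distrib, Finset.erase_eq_of_notMem (s := B)]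
      exact Finset.disjoint_left.1 hd (hA a ha)
    · refine Finset.sum_congr rfl fun a ha => ?_
      rw [Finset.erase_union_distrib, Finset.erase_eq_of_notMem (s := A)]
      exact Finset.disjoint_right.1 hd (hB a ha)
  · exact Finset.disjoint_left.2 fun a h1 h2 => Finset.disjoint_left.1 hd (hA a h1) (hB a h2)

/-- Words on `A ∪ B` are shuffles. Peeling the first letter, `a` or `b`, reduces the claim to
1/((a-y)(b-a)) + 1/((b-y)(a-b)) = 1/((a-y)(b-y)). -/
theorem pathSum_union (hx : Function.Injective x) (n : ℕ) (hn : (A ∪ B).card = n)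
    (hd : Disjoint A B) (hAB : ∀ a ∈ A, ∀ b ∈ B, ¬ H.Adj a b ∧ ¬ H.Adj b a) (y : L)
    (hy : ∀ a ∈ A ∪ B, x a ≠ y) :
    pathSum x H (A ∪ B) y = pathSum x H A y * pathSum x H B y := by
  induction n generalizing A B y with
  | zero =>
    rw [Finset.card_eq_zero, Finset.union_eq_empty] at hn
    simp [hn.1, hn.2, pathSum_empty]
  | succ n ih =>
    rcases A.eq_empty_or_nonempty with rfl | hA
    · simp [pathSum_empty]
    rcases B.eq_empty_or_nonempty with rfl | hB
    · simp [pathSum_empty]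
    have hmA : ∀ a ∈ H.maximalIn A, a ∈ A := fun a ha => (mem_maximalIn.1 ha).1
    have hmB : ∀ a ∈ H.maximalIn B, a ∈ B := fun a ha => (mem_maximalIn.1 ha).1
    rw [pathSum_eq (hA.mono Finset.subset_union_left),
      sum_maximalIn_union (fun S m => (x m - y)⁻¹ * pathSum x H S (x m)) hd hAB]
    have h1 : ∀ a ∈ H.maximalIn A, (x a - y)⁻¹ * pathSum x H (A.erase a ∪ B) (x a) =
        ∑ b ∈ H.maximalIn B, (x a - y)⁻¹ * (x b - x a)⁻¹ *
          (pathSum x H (A.erase a) (x a) * pathSum x H (B.erase b) (x b)) := by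
      intro a ha
      have haB : a ∉ B := Finset.disjoint_left.1 hd (hmA a ha)
      have he : A.erase a ∪ B = (A ∪ B).erase a := by
        rw [Finset.erase_union_distrib, Finset.erase_eq_of_notMem haB]
      rw [ih (A := A.erase a) (B := B), pathSum_eq hB, Finset.mul_sum, Finset.mul_sum]
      · exact Finset.sum_congr rfl fun b _ => by ring
      · rw [he, Finset.card_erase_of_mem (Finset.mem_union_left _ (hmA a ha)), hn]; rfl
      · exact hd.mono_left (Finset.erase_subset _ _)
      · exact fun a ha => hAB a (Finset.mem_of_mem_erase ha)
      · rw [he]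
        exact fun b hb h => (Finset.mem_erase.1 hb).1 (hx h)
    have h2 : ∀ b ∈ H.maximalIn B, (x b - y)⁻¹ * pathSum x H (A ∪ B.erase b) (x b) =
        ∑ a ∈ H.maximalIn A, (x b - y)⁻¹ * (x a - x b)⁻¹ *
          (pathSum x H (A.erase a) (x a) * pathSum x H (B.erase b) (x b)) := by
      intro b hb
      have hbA : b ∉ A := Finset.disjoint_right.1 hd (hmB b hb)
      have he : A ∪ B.erase b = (A ∪ B).erase b := by
        rw [Finset.erase_union_distrib, Finset.erase_eq_of_notMem hbA]
      rw [ih (A := A) (B := B.erase b), pathSum_eq hA, Finset.sum_mul, Finset.mul_sum]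
      · exact Finset.sum_congr rfl fun b _ => by ring
      · rw [he, Finset.card_erase_of_mem (Finset.mem_union_right _ (hmB b hb)), hn]; rfl
      · exact hd.mono_right (Finset.erase_subset _ _)
      · exact fun a ha b hb => hAB a ha b (Finset.mem_of_mem_erase hb)
      · rw [he]
        exact fun c hc h => (Finset.mem_erase.1 hc).1 (hx h)
    rw [Finset.sum_congr rfl h1, Finset.sum_congr rfl h2, Finset.sum_comm (s := H.maximalIn B),
      ← Finset.sum_add_distrib, pathSum_eq hA, pathSum_eq hB, Finset.sum_mul_sum]
    refine Finset.sum_congr rfl fun a ha => ?_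
    rw [← Finset.sum_add_distrib]
    refine Finset.sum_congr rfl fun b hb => ?_
    have e1 : x a - y ≠ 0 := sub_ne_zero.2 (hy a (Finset.mem_union_left _ (hmA a ha)))
    have e2 : x b - y ≠ 0 := sub_ne_zero.2 (hy b (Finset.mem_union_right _ (hmB b hb)))
    have e3 : x b - x a ≠ 0 := sub_ne_zero.2 fun h => Finset.disjoint_left.1 hd (hmA a ha)
      (hx h ▸ hmB b hb)
    have e4 : (x a - x b)⁻¹ = -(x b - x a)⁻¹ := by rw [← inv_neg, neg_sub]
    rw [e4]
    field_simp
    ring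

/-- The sum of the weights of words vanishes for a disconnected graph. -/
theorem wordSum_union_eq_zero (hx : Function.Injective x) (hA : A.Nonempty) (hB : B.Nonempty)
    (hd : Disjoint A B) (hAB : ∀ a ∈ A, ∀ b ∈ B, ¬ H.Adj a b ∧ ¬ H.Adj b a) :
    wordSum x H (A ∪ B) = 0 := by
  have hmA : ∀ a ∈ H.maximalIn A, a ∈ A := fun a ha => (mem_maximalIn.1 ha).1
  have hmB : ∀ a ∈ H.maximalIn B, a ∈ B := fun a ha => (mem_maximalIn.1 ha).1
  rw [wordSum_eq (hA.mono Finset.subset_union_left),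
    sum_maximalIn_union (fun S m => pathSum x H S (x m)) hd hAB]
  have h1 : ∀ a ∈ H.maximalIn A, pathSum x H (A.erase a ∪ B) (x a) =
      ∑ b ∈ H.maximalIn B, (x b - x a)⁻¹ *
        (pathSum x H (A.erase a) (x a) * pathSum x H (B.erase b) (x b)) := by
    intro a ha
    have haB : a ∉ B := Finset.disjoint_left.1 hd (hmA a ha)
    rw [pathSum_union hx _ rfl, pathSum_eq hB, Finset.mul_sum]
    · exact Finset.sum_congr rfl fun b _ => by ring
    · exact hd.mono_left (Finset.erase_subset _ _)
    · exact fun a ha => hAB a (Finset.mem_of_mem_erase ha)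
    · rintro c hc h
      obtain rfl := hx h
      simp [haB] at hc
  have h2 : ∀ b ∈ H.maximalIn B, pathSum x H (A ∪ B.erase b) (x b) =
      ∑ a ∈ H.maximalIn A, (x a - x b)⁻¹ *
        (pathSum x H (A.erase a) (x a) * pathSum x H (B.erase b) (x b)) := by
    intro b hb
    have hbA : b ∉ A := Finset.disjoint_right.1 hd (hmB b hb)
    rw [pathSum_union hx _ rfl, pathSum_eq hA, Finset.sum_mul]
    · exact Finset.sum_congr rfl fun b _ => by ring
    · exact hd.mono_right (Finset.erase_subset _ _)
    · exact fun a ha b hb => hAB a ha b (Finset.mem_of_mem_erase hb)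
    · rintro c hc h
      obtain rfl := hx h
      simp [hbA] at hc
  rw [Finset.sum_congr rfl h1, Finset.sum_congr rfl h2, Finset.sum_comm (s := H.maximalIn B),
    ← Finset.sum_add_distrib]
  refine Finset.sum_eq_zero fun a _ => ?_
  -- Without a leading value the two orders of the first letters `a`, `b` cancel: 1/(b-a) + 1/(a-b)
  -- = 0.
  rw [← Finset.sum_add_distrib]
  refine Finset.sum_eq_zero fun b _ => ?_
  rw [← neg_sub (x b) (x a), inv_neg]
  ring

/-- A vertex `c` whose only edge leads to `p` can be removed without changing the maximal vertices. -/
theorem maximalIn_erase_leaf {c p : V} (hc : c ∈ S) (hp : p ∈ S) (hcp : c ≠ p)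
    (hadj : H.Adj c p) (h : ∀ b ∈ S, ¬ H.Adj b c) :
    H.maximalIn S = H.maximalIn (S.erase c) := by
  ext m
  simp only [mem_maximalIn, Finset.mem_erase]
  constructor
  · rintro ⟨hm, hm'⟩
    refine ⟨⟨?_, hm⟩, fun b hb => hm' b hb.2⟩
    rintro rfl
    exact hm' p hp hcp.symm hadj
  · rintro ⟨⟨hmc, hm⟩, hm'⟩
    refine ⟨hm, fun b hb hbm => ?_⟩
    by_cases hbc : b = c
    · exact hbc ▸ h m hm
    · exact hm' b ⟨hbc, hb⟩ hbm

/-- Once `p` itself is peeled off, `c` is isolated and `pathSum_union` splits off its factor.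
Peeling any other vertex keeps the leaf situation, which is left to `ih`. -/
theorem pathSum_leaf_aux (hx : Function.Injective x) {c p m : V} (hc : c ∈ S) (hcp : c ≠ p)
    (h : ∀ b ∈ S, ¬ H.Adj b c) (h' : ∀ b ∈ S, b ≠ p → ¬ H.Adj c b)
    (ih : m ≠ p → pathSum x H (S.erase m) (x m) =
      (x c - x p)⁻¹ * pathSum x H ((S.erase m).erase c) (x m)) :
    pathSum x H (S.erase m) (x m) =
      (x c - x p)⁻¹ * pathSum x H ((S.erase c).erase m) (x m) := by
  rw [Finset.erase_right_comm (a := c)]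
  by_cases hmp : m = p
  · subst hmp
    have he : S.erase m = {c} ∪ (S.erase m).erase c := by
      rw [← Finset.insert_eq, Finset.insert_erase (Finset.mem_erase.2 ⟨hcp, hc⟩)]
    conv_lhs => rw [he]
    rw [pathSum_union hx _ rfl, pathSum_singleton]
    · simp
    · intro a ha b hb
      rw [Finset.mem_singleton.1 ha]
      simp only [Finset.mem_erase] at hb
      exact ⟨h' b hb.2.2 hb.2.1, h b hb.2.2⟩
    · rw [← he]
      exact fun b hb he => (Finset.mem_erase.1 hb).1 (hx he)
  · exact ih hmp

theorem pathSum_leaf (hx : Function.Injective x) {c p : V} (n : ℕ) (hn : S.card = n) (hc : c ∈ S)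
    (hp : p ∈ S) (hcp : c ≠ p) (hadj : H.Adj c p)
    (h : ∀ b ∈ S, ¬ H.Adj b c) (h' : ∀ b ∈ S, b ≠ p → ¬ H.Adj c b) (y : L) :
    pathSum x H S y = (x c - x p)⁻¹ * pathSum x H (S.erase c) y := by
  induction n generalizing S y with
  | zero => simp [Finset.card_eq_zero.1 hn] at hc
  | succ n ih =>
    rw [pathSum_eq ⟨c, hc⟩, pathSum_eq ⟨p, Finset.mem_erase.2 ⟨hcp.symm, hp⟩⟩,
      maximalIn_erase_leaf hc hp hcp hadj h, Finset.mul_sum]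
    refine Finset.sum_congr rfl fun m hm => ?_
    have hmS := Finset.mem_erase.1 (mem_maximalIn.1 hm).1
    rw [pathSum_leaf_aux hx hc hcp h h' fun hmp => ?_]
    · ring
    · exact ih (by rw [Finset.card_erase_of_mem hmS.2, hn]; rfl)
        (Finset.mem_erase.2 ⟨hmS.1.symm, hc⟩) (Finset.mem_erase.2 ⟨fun h => hmp h.symm, hp⟩)
        (fun b hb => h b (Finset.mem_of_mem_erase hb))
        (fun b hb => h' b (Finset.mem_of_mem_erase hb)) _

theorem wordSum_leaf (hx : Function.Injective x) {c p : V} (hc : c ∈ S)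
    (hp : p ∈ S) (hcp : c ≠ p) (hadj : H.Adj c p)
    (h : ∀ b ∈ S, ¬ H.Adj b c) (h' : ∀ b ∈ S, b ≠ p → ¬ H.Adj c b) :
    wordSum x H S = (x c - x p)⁻¹ * wordSum x H (S.erase c) := by
  rw [wordSum_eq ⟨c, hc⟩, wordSum_eq ⟨p, Finset.mem_erase.2 ⟨hcp.symm, hp⟩⟩,
    maximalIn_erase_leaf hc hp hcp hadj h, Finset.mul_sum]
  refine Finset.sum_congr rfl fun m hm => ?_
  have hmS := Finset.mem_erase.1 (mem_maximalIn.1 hm).1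
  exact pathSum_leaf_aux hx hc hcp h h' fun hmp =>
    pathSum_leaf hx _ rfl (Finset.mem_erase.2 ⟨hmS.1.symm, hc⟩)
        (Finset.mem_erase.2 ⟨fun h => hmp h.symm, hp⟩) hcp hadj
        (fun b hb => h b (Finset.mem_of_mem_erase hb))
        (fun b hb => h' b (Finset.mem_of_mem_erase hb)) _

end Words

/-! ### Linear extensions as decreasing words -/

section Linear

variable {V : Type*} [Fintype V]

theorem mem_linearExtensions {H : Digraph V} {w : Fin (Fintype.card V) ≃ V} :
    w ∈ H.linearExtensions ↔ ∀ i j, H.Adj (w i) (w j) → i ≤ j := by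
  simp only [linearExtensions, Finset.mem_filter, Finset.mem_univ, true_and]
  exact ⟨fun h i j hij => by simpa using h _ _ hij,
    fun h v v' hv => h _ _ (by simpa using hv)⟩

theorem Psi_eq_wordSum (K : Type*) [Field K] (H : Digraph V) :
    H.Psi K = wordSum (ratVar K) H Finset.univ := by
  classical
  rw [Psi, wordSum]
  refine Finset.sum_bij (fun w _ => List.ofFn fun i => w i.rev) ?_ ?_ ?_
    fun w _ => wordWeight_ofFn_rev _ _
  · intro w hw
    rw [mem_linearExtensions] at hw
    rw [mem_descendingWords]
    refine ⟨List.nodup_ofFn.2 fun i j h => by simpa using h, fun a => ?_, ?_⟩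
    · simp only [Finset.mem_univ, iff_true, List.mem_ofFn]
      exact ⟨(w.symm a).rev, by simp⟩
    · rw [List.pairwise_ofFn]
      intro i j hij h
      exact absurd (hw _ _ h) (by simpa using hij)
  · intro w _ w' _ h
    ext i
    simpa using congrFun (List.ofFn_injective h) i.rev
  · intro l hl
    obtain ⟨hn, hl, hp⟩ := mem_descendingWords.1 hl
    have hlen : Fintype.card V = l.length := by
      rw [← List.toFinset_card_of_nodup hn, ← Finset.card_univ]
      congr 1
      ext a
      simp [hl a]
    let e : Fin l.length ≃ V := List.Nodup.getEquivOfForallMemList l hn fun a => by simp [hl a]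
    let w : Fin (Fintype.card V) ≃ V := (Fin.revPerm.trans (finCongr hlen)).trans e
    have hw : (List.ofFn fun i => w i.rev) = l := by
      refine List.ext_getElem (by simp [hlen]) fun i h1 h2 => ?_
      simp [w, e, List.Nodup.getEquivOfForallMemList]
    refine ⟨w, ?_, hw⟩
    rw [mem_linearExtensions]
    intro i j hij
    by_contra hlt
    rw [← hw, List.pairwise_ofFn] at hp
    refine hp (i := i.rev) (j := j.rev) (by simpa using hlt) ?_
    simpa using hij

end Linear

end Digraph

namespace Digraph

/-! ### Trees -/

section Trees

variable {V : Type*}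

/-- The digraph with a given finite set of edges. -/
def ofEdges (F : Finset (V × V)) : Digraph V := ⟨fun a b => (a, b) ∈ F⟩

theorem ofEdges_adj {F : Finset (V × V)} {a b : V} : (ofEdges F).Adj a b ↔ (a, b) ∈ F := Iff.rfl

section Counting

variable [Fintype V]

theorem mem_edgeFinset {H : Digraph V} {e : V × V} : e ∈ H.edgeFinset ↔ H.Adj e.1 e.2 := by
  simp [edgeFinset]

theorem edgeFinset_ofEdges (F : Finset (V × V)) : (ofEdges F).edgeFinset = F := by
  ext e
  rw [mem_edgeFinset]
  rfl

theorem IsConnected.card_le {T : Digraph V} (h : T.IsConnected) :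
    Fintype.card V ≤ T.edgeFinset.card + 1 := by
  classical
  have h1 := SimpleGraph.Connected.card_vert_le_card_edgeSet_add_one h
  rw [Nat.card_eq_fintype_card] at h1
  refine h1.trans (Nat.add_le_add_right ?_ 1)
  -- Loops disappear and opposite edges merge in the simple graph, so its edge count is only bounded
  -- by that of `T`.
  have hsub : T.toSimpleGraphInclusive.edgeSet ⊆
      ((T.edgeFinset.image fun e => s(e.1, e.2) : Finset (Sym2 V)) : Set (Sym2 V)) := by
    intro e
    induction e with
    | _ a b =>
      intro hab
      rw [SimpleGraph.mem_edgeSet] at hab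
      rw [Finset.mem_coe, Finset.mem_image]
      rcases hab.2 with h | h
      · exact ⟨(a, b), mem_edgeFinset.2 h, rfl⟩
      · exact ⟨(b, a), mem_edgeFinset.2 h, Sym2.eq_swap⟩
  calc Nat.card T.toSimpleGraphInclusive.edgeSet
      ≤ (T.edgeFinset.image fun e => s(e.1, e.2)).card := by
        rw [Nat.card_coe_set_eq, ← Set.ncard_coe_finset]
        exact Set.ncard_le_ncard hsub (Finset.finite_toSet _)
    _ ≤ T.edgeFinset.card := Finset.card_image_le

theorem isTree_iff {T : Digraph V} :
    T.IsTree ↔ T.IsConnected ∧ T.edgeFinset.card + 1 = Fintype.card V := by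
  refine and_congr_right fun h => ?_
  have : Nat.card T.toSimpleGraphInclusive.ConnectedComponent = 1 := by
    have := SimpleGraph.Connected.nonempty h
    have := (SimpleGraph.Connected.preconnected h).subsingleton_connectedComponent
    exact Nat.card_unique
  rw [IsForest, cyclomaticNumber, this]
  omega

end Counting

variable [DecidableEq V]

/-- Trees obtained from a root `r` by adding leaves: `W` is the set of vertices, `F` the set of
edges and `A` the set of edges oriented towards the root. -/
inductive GrownTree (r : V) : Finset V → Finset (V × V) → Finset (V × V) → Prop
  | root : GrownTree r {r} ∅ ∅
  | add {W : Finset V} {F A : Finset (V × V)} {c p : V} {e : V × V} (h : GrownTree r W F A)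
      (hp : p ∈ W) (hc : c ∉ W) (he : e = (c, p) ∨ e = (p, c)) :
      GrownTree r (insert c W) (insert e F) (insert (c, p) A)

namespace GrownTree

variable {r : V} {W : Finset V} {F A : Finset (V × V)}

theorem root_mem (h : GrownTree r W F A) : r ∈ W := by
  induction h with
  | root => simp
  | add _ _ _ _ ih => exact Finset.mem_insert_of_mem ih

theorem ends_mem (h : GrownTree r W F A) {e : V × V} (he : e ∈ F) : e.1 ∈ W ∧ e.2 ∈ W := by
  induction h with
  | root => simp at he
  | add h hp hc he' ih =>
    rw [Finset.mem_insert] at he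
    rcases he with rfl | he
    · rcases he' with rfl | rfl <;> simp [hp]
    · exact ⟨Finset.mem_insert_of_mem (ih he).1, Finset.mem_insert_of_mem (ih he).2⟩

theorem oriented_ends_mem (h : GrownTree r W F A) {e : V × V} (he : e ∈ A) :
    e.1 ∈ W ∧ e.2 ∈ W := by
  induction h with
  | root => simp at he
  | add h hp hc he' ih =>
    rw [Finset.mem_insert] at he
    rcases he with rfl | he
    · simp [hp]
    · exact ⟨Finset.mem_insert_of_mem (ih he).1, Finset.mem_insert_of_mem (ih he).2⟩

theorem card_add_one (h : GrownTree r W F A) : F.card + 1 = W.card := by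
  induction h with
  | root => simp
  | @add W F A c p e h hp hc he ih =>
    rw [Finset.card_insert_of_notMem hc, Finset.card_insert_of_notMem, ih]
    intro he'
    have := h.ends_mem he'
    rcases he with rfl | rfl
    · exact hc this.1
    · exact hc this.2

theorem reachable (h : GrownTree r W F A) {T : Digraph V} (hT : ∀ e ∈ F, T.Adj e.1 e.2) {a : V}
    (ha : a ∈ W) : T.toSimpleGraphInclusive.Reachable r a := by
  induction h generalizing a with
  | root => rw [Finset.mem_singleton.1 ha]
  | @add W F A c p e h hp hc he ih =>
    have ih' := fun {a} => @ih (fun e he => hT e (Finset.mem_insert_of_mem he)) a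
    rw [Finset.mem_insert] at ha
    rcases ha with rfl | ha
    · refine (ih' hp).trans (SimpleGraph.Adj.reachable ⟨fun h => hc (h ▸ hp), ?_⟩)
      have := hT e (Finset.mem_insert_self _ _)
      rcases he with rfl | rfl
      · exact .inr this
      · exact .inl this
    · exact ih' ha

theorem isTree [Fintype V] (h : GrownTree r Finset.univ F A) : (ofEdges F).IsTree := by
  rw [isTree_iff, edgeFinset_ofEdges, h.card_add_one, Finset.card_univ]
  have hr : ∀ a, (ofEdges F).toSimpleGraphInclusive.Reachable r a := fun a =>
    h.reachable (fun e he => he) (Finset.mem_univ a)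
  exact ⟨(SimpleGraph.connected_iff _).2 ⟨fun a b => (hr a).symm.trans (hr b), ⟨r⟩⟩, rfl⟩

/-- A tree containing a grown tree has no other edge between vertices of the latter. -/
theorem not_isTree [Fintype V] (h : GrownTree r W F A) {T : Digraph V}
    (hT : ∀ e ∈ F, T.Adj e.1 e.2) {e : V × V} (heF : e ∉ F) (he : T.Adj e.1 e.2) (h1 : e.1 ∈ W)
    (h2 : e.2 ∈ W) : ¬ T.IsTree := by
  rw [isTree_iff]
  rintro ⟨hc, hcard⟩
  -- The grown tree already joins the ends of `e`, so `T` stays connected without `e`, with too few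
  -- edges if `T` is a tree.
  have hr : ∀ a ∈ W, (ofEdges (T.edgeFinset.erase e)).toSimpleGraphInclusive.Reachable r a :=
    fun a ha => h.reachable (fun f hf => Finset.mem_erase.2
      ⟨ne_of_mem_of_not_mem hf heF, mem_edgeFinset.2 (hT f hf)⟩) ha
  have hadj : ∀ a b, T.toSimpleGraphInclusive.Adj a b →
      (ofEdges (T.edgeFinset.erase e)).toSimpleGraphInclusive.Reachable a b := by
    rintro a b ⟨hne, hab⟩
    by_cases hab' : a ∈ W ∧ b ∈ W
    · exact (hr a hab'.1).symm.trans (hr b hab'.2)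
    · refine SimpleGraph.Adj.reachable ⟨hne, hab.imp (fun hab => ?_) fun hab => ?_⟩
      · exact Finset.mem_erase.2 ⟨by rintro rfl; exact hab' ⟨h1, h2⟩, mem_edgeFinset.2 hab⟩
      · exact Finset.mem_erase.2 ⟨by rintro rfl; exact hab' ⟨h2, h1⟩, mem_edgeFinset.2 hab⟩
  have hc' : (ofEdges (T.edgeFinset.erase e)).IsConnected := by
    refine (SimpleGraph.connected_iff _).2 ⟨fun a b => ?_, SimpleGraph.Connected.nonempty hc⟩
    have := SimpleGraph.Connected.preconnected hc a b
    rw [SimpleGraph.reachable_iff_reflTransGen] at this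
    induction this with
    | refl => rfl
    | tail _ h ih => exact ih.trans (hadj _ _ h)
  have := hc'.card_le
  rw [edgeFinset_ofEdges, Finset.card_erase_of_mem (mem_edgeFinset.2 he)] at this
  have := Finset.card_pos.2 ⟨e, mem_edgeFinset.2 he⟩
  omega

/-- The last vertex added is a leaf whose only edge in `A` points to its parent, whatever the
orientation of the original edge; `wordSum_leaf` removes it together with its factor. -/
theorem wordSum_mul_prod (h : GrownTree r W F A) {L : Type*} [Field L] {x : V → L}
    (hx : Function.Injective x) :
    wordSum x (ofEdges A) W * ∏ e ∈ A, (x e.1 - x e.2) = 1 := by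
  induction h with
  | root => simp [wordSum_singleton]
  | @add W F A c p e h hp hc he ih =>
    have hcp : c ≠ p := fun h => hc (h ▸ hp)
    have hA : ∀ a b, (a, b) ∈ A → a ≠ c ∧ b ≠ c := fun a b hab =>
      ⟨fun h' => hc (h' ▸ (h.oriented_ends_mem hab).1),
        fun h' => hc (h' ▸ (h.oriented_ends_mem hab).2)⟩
    have hA' : (c, p) ∉ A := fun h' => (hA _ _ h').1 rfl
    rw [wordSum_leaf hx (c := c) (p := p) (Finset.mem_insert_self _ _)
      (Finset.mem_insert_of_mem hp) hcp (Finset.mem_insert_self _ _), Finset.prod_insert hA',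
      Finset.erase_insert hc, wordSum, descendingWords_congr (H' := ofEdges A), ← wordSum,
      mul_mul_mul_comm, ih, mul_one, inv_mul_cancel₀ (sub_ne_zero.2 fun h => hcp (hx h))]
    · intro a ha b hb
      rw [ofEdges_adj, ofEdges_adj, Finset.mem_insert]
      refine or_iff_right ?_
      rintro h
      obtain ⟨rfl, rfl⟩ := Prod.mk.inj h
      exact hc ha
    · intro b hb hbc
      rcases Finset.mem_insert.1 hbc with h | h
      · exact hcp (Prod.mk.inj h).2
      · exact (hA _ _ h).2 rfl
    · intro b hb hbp hcb
      rcases Finset.mem_insert.1 hcb with h | h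
      · exact hbp (Prod.mk.inj h).2
      · exact (hA _ _ h).1 rfl

end GrownTree

end Trees

end Digraph

/-! ### Tours -/

/-- The step leaving the last entry plays no role in a chain. Two tours that treat the earlier darts
alike therefore agree up to and including the next dart. -/
theorem List.IsChain.imp_append_singleton {α : Type*} {R S : α → α → Prop} {l : List α} {b : α}
    (h : (l ++ [b]).IsChain R) (H : ∀ a ∈ l, ∀ c, R a c → S a c) : (l ++ [b]).IsChain S := by
  induction l with
  | nil => simp
  | cons a l ih =>
    rw [List.cons_append, List.isChain_cons] at h ⊢
    exact ⟨fun c hc => H a (by simp) c (h.1 c hc), ih h.2 fun a ha => H a (by simp [ha])⟩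

/-- The orbit of `a` under a permutation, as a word starting with `a`. -/
theorem Equiv.Perm.exists_orbit_list {α : Type*} [Finite α] (σ : Equiv.Perm α) (a : α) :
    ∃ K : List α, (a :: K).Nodup ∧ (∀ b, b ∈ a :: K ↔ σ.SameCycle a b) ∧
      (a :: (K ++ [a])).IsChain fun b c => σ b = c := by
  have hpos : 0 < Function.minimalPeriod σ a :=
    Function.minimalPeriod_pos_of_mem_periodicPts
      (Function.Injective.mem_periodicPts σ.injective a)
  obtain ⟨k, hk⟩ := Nat.exists_eq_succ_of_ne_zero hpos.ne'
  have h1 : a :: (List.range k).map (fun i => σ^[i + 1] a) =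
      (List.range (k + 1)).map fun i => σ^[i] a := by
    rw [List.range_succ_eq_map, List.map_cons, List.map_map]
    rfl
  have h2 : a :: ((List.range k).map (fun i => σ^[i + 1] a) ++ [a]) =
      (List.range (k + 2)).map fun i => σ^[i] a := by
    rw [← List.cons_append, h1, List.range_succ (n := k + 1), List.map_append, List.map_singleton,
      ← Nat.succ_eq_add_one k, ← hk, Function.iterate_minimalPeriod]
  refine ⟨(List.range k).map fun i => σ^[i + 1] a, ?_, fun b => ?_, ?_⟩
  · rw [h1]
    refine List.Nodup.map_on (fun i hi j hj h => ?_) List.nodup_range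
    rw [List.mem_range, ← Nat.succ_eq_add_one, ← hk] at hi hj
    exact Function.iterate_injOn_Iio_minimalPeriod hi hj h
  · rw [h1, List.mem_map]
    constructor
    · rintro ⟨i, -, rfl⟩
      exact ⟨i, by rw [zpow_natCast, Equiv.Perm.iterate_eq_pow]⟩
    · intro h
      obtain ⟨i, hi⟩ := h.exists_nat_pow_eq
      refine ⟨i % Function.minimalPeriod σ a, ?_, ?_⟩
      · rw [List.mem_range, ← Nat.succ_eq_add_one, ← hk]
        exact Nat.mod_lt _ hpos
      · rw [Function.iterate_mod_minimalPeriod_eq, Equiv.Perm.iterate_eq_pow, hi]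
  · rw [h2, List.isChain_iff_getElem]
    intro i hi
    simp only [List.getElem_map, List.getElem_range, Function.iterate_succ_apply']

namespace Digraph

variable {V : Type*} {G : Digraph V}

theorem Dart.edge_inl (e : G.Edge) : Dart.edge (Sum.inl e : G.Dart) = e := rfl

theorem Dart.edge_inr (e : G.Edge) : Dart.edge (Sum.inr e : G.Dart) = e := rfl

theorem Dart.extremity_inl (e : G.Edge) : Dart.extremity (Sum.inl e : G.Dart) = e.1.1 := rfl

theorem Dart.extremity_inr (e : G.Edge) : Dart.extremity (Sum.inr e : G.Dart) = e.1.2 := rfl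

theorem Dart.edge_swap (h : G.Dart) : Dart.edge h.swap = Dart.edge h := by
  rcases h with e | e <;> rfl

theorem Dart.eq_or_eq_swap_of_edge_eq {h k : G.Dart} (hk : Dart.edge k = Dart.edge h) :
    k = h ∨ k = h.swap := by
  rcases h with e | e <;> rcases k with f | f <;> simp_all [Dart.edge]

theorem Dart.extremity_of_edge {h : G.Dart} {W : Finset V}
    (hW : (Dart.edge h).1.1 ∈ W ∧ (Dart.edge h).1.2 ∈ W) :
    Dart.extremity h ∈ W ∧ Dart.extremity h.swap ∈ W := by
  rcases h with e | e
  · exact hW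
  · exact hW.symm

namespace RootedMap

theorem cross_of_adj {T : Digraph V} {h : G.Dart}
    (hT : T.Adj (Dart.edge h).1.1 (Dart.edge h).1.2) : cross T (some h) = some h.swap := by
  simp [cross, hT]

theorem cross_of_not_adj {T : Digraph V} {h : G.Dart}
    (hT : ¬ T.Adj (Dart.edge h).1.1 (Dart.edge h).1.2) : cross T (some h) = some h := by
  simp [cross, hT]

variable (M : G.RootedMap)

/-- The external dart lies in the orbit of `star`, so every other orbit consists of genuine darts.
-/
theorem exists_orbit_list_some [Finite V] {h : G.Dart} (hh : Dart.extremity h ≠ M.star) :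
    ∃ K : List G.Dart, (h :: K).Nodup ∧
      (∀ k, k ∈ h :: K ↔ Dart.extremity k = Dart.extremity h) ∧
      (some h :: (K.map some ++ [some h])).IsChain fun b c => M.next b = c := by
  obtain ⟨K, h1, h2, h3⟩ := M.next.exists_orbit_list (some h)
  have hsome : ∃ K' : List G.Dart, K = K'.map some := by
    refine ⟨K.reduceOption, ?_⟩
    have hn : ∀ k ∈ K, k ≠ none := by
      rintro k hk rfl
      exact hh ((M.sameCycle_iff _ _).1 ((h2 none).1 (List.mem_cons_of_mem _ hk)))
    clear h1 h2 h3
    induction K with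
    | nil => rfl
    | cons k K ih =>
      rcases k with _ | k
      · exact absurd rfl (hn _ (by simp))
      · rw [List.reduceOption_cons_of_some, List.map_cons, ← ih fun k hk => hn k (by simp [hk])]
  obtain ⟨K, rfl⟩ := hsome
  refine ⟨K, ?_, fun k => ?_, h3⟩
  · rw [← List.map_cons] at h1
    exact h1.of_map
  · have := h2 (some k)
    rw [← List.map_cons, List.mem_map_of_injective (Option.some_injective _),
      M.sameCycle_iff] at this
    rw [this, eq_comm]
    rfl

theorem exists_orbit_list_none [Finite V] :
    ∃ K : List G.Dart, K.Nodup ∧ (∀ k, k ∈ K ↔ Dart.extremity k = M.star) ∧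
      (none :: (K.map some ++ [none])).IsChain fun b c => M.next b = c := by
  obtain ⟨K, h1, h2, h3⟩ := M.next.exists_orbit_list none
  have hsome : ∃ K' : List G.Dart, K = K'.map some := by
    refine ⟨K.reduceOption, ?_⟩
    have hn : none ∉ K := (List.nodup_cons.1 h1).1
    clear h1 h2 h3
    induction K with
    | nil => rfl
    | cons k K ih =>
      rcases k with _ | k
      · simp at hn
      · rw [List.reduceOption_cons_of_some, List.map_cons,
          ← ih fun hk => hn (List.mem_cons_of_mem _ hk)]
  obtain ⟨K, rfl⟩ := hsome
  refine ⟨K, (List.nodup_cons.1 h1).2.of_map, fun k => ?_, h3⟩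
  have := h2 (some k)
  rw [List.mem_cons, or_iff_right (by simp), List.mem_map_of_injective (Option.some_injective _),
    M.sameCycle_iff] at this
  rw [this, eq_comm]
  rfl

variable {M} {T : Digraph V}

theorem tour_eq_getElem {l : List (Option G.Dart)}
    (h : (none :: l).IsChain fun b c => M.tourStep T b = c) (n : ℕ) (hn : n < (none :: l).length) :
    M.tour T n = (none :: l)[n] := by
  induction n with
  | zero => rfl
  | succ n ih =>
    rw [tour, Function.iterate_succ_apply', ← tour, ih (by omega)]
    exact List.isChain_iff_getElem.1 h n hn

theorem tourBefore_of_isChain {X : List G.Dart} {h h' : G.Dart}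
    (hc : (none :: (X.map some ++ [some h])).IsChain fun b c => M.tourStep T b = c)
    (hX : h' ∉ X) (hne : h' ≠ h) : M.TourBefore T h h' := by
  have ht := tour_eq_getElem hc
  -- The shift by one accounts for the external dart at time 0.
  refine ⟨X.length + 1, ?_, fun m hm => ?_⟩
  · rw [ht _ (by simp)]
    simp
  · rw [ht _ (by simp; omega)]
    intro heq
    have : some h' ∈ none :: (X.map some ++ [some h]) := heq ▸ List.getElem_mem _
    simp [hX, hne] at this

theorem not_tourBefore_of_isChain {X : List G.Dart} {h h' : G.Dart}
    (hc : (none :: (X.map some ++ [some h'])).IsChain fun b c => M.tourStep T b = c)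
    (hX : h ∉ X) (hne : h ≠ h') : ¬ M.TourBefore T h h' := by
  have ht := tour_eq_getElem hc
  rintro ⟨n, hn, hm⟩
  by_cases hle : n < X.length + 2
  · have : some h ∈ none :: (X.map some ++ [some h']) := by
      rw [← hn, ht n (by simp; omega)]
      exact List.getElem_mem _
    simp [hX, hne] at this
  · refine hm (X.length + 1) (by omega) ?_
    rw [ht _ (by simp)]
    simp

/-! ### Stages of a tour -/

variable [DecidableEq V] (M)

/-- A stage of the construction of tours: the edges in `D` are decided, those in `F ⊆ D` belong to
the spanning tree. The edges in `F` form a tree with vertex set `W`, oriented towards the root in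
`A`. Its tour runs through the darts in `P`, belonging to decided edges, and then through those
in `L`. -/
structure TourStage (W : Finset V) (F A D : Finset (V × V)) (P L : List G.Dart) : Prop where
  grown : GrownTree M.star W F A
  subset : F ⊆ D
  adj : ∀ e ∈ D, G.Adj e.1 e.2
  chain : (none :: ((P ++ L).map some ++ [none])).IsChain
    fun b c => M.tourStep (ofEdges F) b = c
  nodup : (P ++ L).Nodup
  mem_iff : ∀ h, h ∈ P ++ L ↔ Dart.extremity h ∈ W
  decided : ∀ h ∈ P, (Dart.edge h).1 ∈ D
  good : ∀ e : G.Edge, e.1 ∈ D → e.1 ∉ F → ∃ X Y, P = X ++ Sum.inl e :: Y ∧ Sum.inr e ∉ X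
  ancestors : L.Pairwise fun h h' => Relation.ReflTransGen (fun a b => (a, b) ∈ A)
    (Dart.extremity h) (Dart.extremity h')

variable {M}

theorem exists_tourStage [Finite V] : ∃ L, M.TourStage {M.star} ∅ ∅ ∅ [] L := by
  obtain ⟨K, h1, h2, h3⟩ := M.exists_orbit_list_none
  -- The tour of the empty edge set only turns around `star`.
  refine ⟨K, .root, by simp, by simp, ?_, h1, by simpa using h2, by simp, by simp, ?_⟩
  · refine h3.imp fun b c h => ?_
    rcases b with _ | b
    · exact h
    · rw [tourStep, cross_of_not_adj (by simp [ofEdges_adj]), h]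
  · refine List.pairwise_of_forall_mem_list fun a ha b hb => ?_
    rw [(h2 a).1 ha, (h2 b).1 hb]

namespace TourStage

variable {W : Finset V} {F A D : Finset (V × V)} {P L : List G.Dart} {h : G.Dart}

/-- Every spanning tree that agrees with the decisions made has the same tour at the beginning. -/
theorem isChain_prefix (s : M.TourStage W F A D P L) (hT : ∀ e ∈ D, T.Adj e.1 e.2 ↔ e ∈ F)
    {X Y : List G.Dart} (hXY : P ++ L = X ++ h :: Y) (hX : ∀ k ∈ X, k ∈ P) :
    (none :: (X.map some ++ [some h])).IsChain fun b c => M.tourStep T b = c := by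
  have hc := s.chain
  rw [hXY, List.map_append, List.map_cons, List.append_assoc, List.cons_append,
    ← List.cons_append, List.isChain_split] at hc
  refine hc.1.imp_append_singleton fun a ha c hac => ?_
  rcases a with _ | a
  · exact hac
  · have haX : a ∈ X := by simpa using ha
    have := hT _ (s.decided a (hX a haX))
    rw [← hac, tourStep, tourStep]
    by_cases h : (Dart.edge a).1 ∈ F
    · rw [cross_of_adj (this.2 h), cross_of_adj (T := ofEdges F) h]
    · rw [cross_of_not_adj (mt this.1 h), cross_of_not_adj (T := ofEdges F) h]

theorem tourBefore (s : M.TourStage W F A D P L) (hT : ∀ e ∈ D, T.Adj e.1 e.2 ↔ e ∈ F)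
    {e : G.Edge} (heD : e.1 ∈ D) (heF : e.1 ∉ F) : M.TourBefore T (Sum.inl e) (Sum.inr e) := by
  obtain ⟨X, Y, rfl, hX⟩ := s.good e heD heF
  exact tourBefore_of_isChain
    (s.isChain_prefix hT (X := X) (Y := Y ++ L) (by simp) (by simp +contextual)) hX (by simp)

/-- All darts in `P` belong to decided edges, so the second dart of the undecided `e` is reached
while its first dart is still unseen. -/
theorem not_tourBefore {e : G.Edge} (s : M.TourStage W F A D P (Sum.inr e :: L))
    (hT : ∀ e ∈ D, T.Adj e.1 e.2 ↔ e ∈ F) (he : e.1 ∉ D) :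
    ¬ M.TourBefore T (Sum.inl e) (Sum.inr e) :=
  not_tourBefore_of_isChain (s.isChain_prefix hT rfl fun _ h => h)
    (fun h => he (s.decided _ h)) (by simp)

theorem skip (s : M.TourStage W F A D P (h :: L)) (hh : (Dart.edge h).1 ∈ D) :
    M.TourStage W F A D (P ++ [h]) L where
  grown := s.grown
  subset := s.subset
  adj := s.adj
  chain := by simpa using s.chain
  nodup := by simpa using s.nodup
  mem_iff := by simpa using s.mem_iff
  decided k hk := by
    rcases List.mem_append.1 hk with hk | hk
    · exact s.decided k hk
    · rwa [List.mem_singleton.1 hk]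
  good e h1 h2 := by
    obtain ⟨X, Y, rfl, hX⟩ := s.good e h1 h2
    exact ⟨X, Y ++ [h], by simp, hX⟩
  ancestors := s.ancestors.of_cons

theorem delete {e : G.Edge} (s : M.TourStage W F A D P (Sum.inl e :: L)) (he : e.1 ∉ D) :
    M.TourStage W F A (insert e.1 D) (P ++ [Sum.inl e]) L where
  grown := s.grown
  subset := s.subset.trans (Finset.subset_insert _ _)
  adj f hf := by
    rcases Finset.mem_insert.1 hf with rfl | hf
    · exact e.2
    · exact s.adj f hf
  chain := by simpa using s.chain
  nodup := by simpa using s.nodup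
  mem_iff := by simpa using s.mem_iff
  decided k hk := by
    rcases List.mem_append.1 hk with hk | hk
    · exact Finset.mem_insert_of_mem (s.decided k hk)
    · rw [List.mem_singleton.1 hk]
      exact Finset.mem_insert_self _ _
  good f h1 h2 := by
    rcases Finset.mem_insert.1 h1 with h1 | h1
    · obtain rfl := Subtype.ext h1
      exact ⟨P, [], rfl, fun h => he (s.decided _ h)⟩
    · obtain ⟨X, Y, rfl, hX⟩ := s.good f h1 h2
      exact ⟨X, Y ++ [Sum.inl e], by simp, hX⟩
  ancestors := s.ancestors.of_cons

/-- Both extremities of an undecided edge whose two darts are in the tour: the second one is an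
ancestor of the first one. -/
theorem reflTransGen (s : M.TourStage W F A D P (h :: L)) (hD : (Dart.edge h).1 ∉ D)
    (hW : Dart.extremity h.swap ∈ W) :
    Relation.ReflTransGen (fun a b => (a, b) ∈ A) (Dart.extremity h) (Dart.extremity h.swap) := by
  have := (s.mem_iff _).2 hW
  -- The other dart cannot be in `P`, whose edges are decided; it is pending, and pending darts come
  -- in order of ancestry.
  rw [List.mem_append, List.mem_cons] at this
  rcases this with hP | hh | hL
  · exact absurd (Dart.edge_swap h ▸ s.decided _ hP) hD
  · rw [hh]
  · exact (List.pairwise_cons.1 s.ancestors).1 _ hL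

theorem extremity_mem (s : M.TourStage W F A D P (h :: L)) : Dart.extremity h ∈ W :=
  (s.mem_iff _).1 (by simp)

/-- Keeping the edge of `h` inserts a full turn around the new vertex: from `h` the tour runs
through `K`, returns by `h.swap`, and leaves `h.swap` as it formerly left `h`. All other steps are
unchanged. -/
theorem isChain_cross (s : M.TourStage W F A D P (h :: L)) (hD : (Dart.edge h).1 ∉ D)
    (hW : Dart.extremity h.swap ∉ W) {K : List G.Dart} (hK : h.swap ∉ K)
    (hKmem : ∀ k ∈ K, Dart.extremity k = Dart.extremity h.swap)
    (hKc : (some h.swap :: (K.map some ++ [some h.swap])).IsChain fun b c => M.next b = c) :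
    (none :: ((P ++ [h] ++ (K ++ h.swap :: L)).map some ++ [none])).IsChain
      fun b c => M.tourStep (ofEdges (insert (Dart.edge h).1 F)) b = c := by
  have hKW : ∀ k ∈ K, Dart.extremity k ∉ W := fun k hk => by
    rwa [hKmem k hk]
  have hnd := s.nodup
  have hPL : ∀ k ∈ P ++ h :: L, Dart.extremity k ∈ W := fun k hk => (s.mem_iff k).1 hk
  have hhP : h ∉ P := fun hP => hD (s.decided _ hP)
  have hstep : ∀ b : Option G.Dart, b ≠ some h → b ≠ some h.swap →
      M.tourStep (ofEdges (insert (Dart.edge h).1 F)) b = M.tourStep (ofEdges F) b := by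
    rintro (_ | b) h1 h2
    · rfl
    · have hb : (Dart.edge b).1 ≠ (Dart.edge h).1 := fun hb => by
        rcases Dart.eq_or_eq_swap_of_edge_eq (Subtype.ext hb) with rfl | rfl
        · exact h1 rfl
        · exact h2 rfl
      rw [tourStep, tourStep]
      by_cases h : (Dart.edge b).1 ∈ F
      · rw [cross_of_adj (T := ofEdges F) h,
          cross_of_adj (T := ofEdges _) (Finset.mem_insert_of_mem h)]
      · rw [cross_of_not_adj (T := ofEdges F) h, cross_of_not_adj (T := ofEdges _)]
        exact fun h' => (Finset.mem_insert.1 h').elim hb h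
  have hF : (Dart.edge h).1 ∉ F := fun h' => hD (s.subset h')
  have hstep_h : M.tourStep (ofEdges (insert (Dart.edge h).1 F)) (some h) =
      M.next (some h.swap) := by
    rw [tourStep, cross_of_adj (T := ofEdges _) (Finset.mem_insert_self _ _)]
  have hstep_swap : M.tourStep (ofEdges (insert (Dart.edge h).1 F)) (some h.swap) =
      M.tourStep (ofEdges F) (some h) := by
    rw [tourStep, tourStep, cross_of_not_adj (T := ofEdges F) hF,
      cross_of_adj (T := ofEdges _), Sum.swap_swap]
    rw [Dart.edge_swap]
    exact Finset.mem_insert_self _ _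
  have hc := s.chain
  have e1 : (none :: ((P ++ h :: L).map some ++ [none]) : List (Option G.Dart)) =
      (none :: P.map some) ++ some h :: (L.map some ++ [none]) := by simp
  have e2 : (none :: ((P ++ [h] ++ (K ++ h.swap :: L)).map some ++ [none]) :
      List (Option G.Dart)) = (none :: P.map some) ++ some h :: (K.map some ++
        some h.swap :: (L.map some ++ [none])) := by simp
  rw [e1, List.isChain_split] at hc
  rw [e2, List.isChain_split,
    ← List.cons_append, List.isChain_split (l₁ := some h :: K.map some)]
  refine ⟨hc.1.imp_append_singleton fun a ha c hac => ?_, ?_, ?_⟩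
  · rw [← hac, hstep]
    · rintro rfl
      simp [hhP] at ha
    · rintro rfl
      have : h.swap ∈ P := by simpa using ha
      exact hW (hPL _ (by simp [this]))
  · rw [List.isChain_cons] at hKc
    rw [List.cons_append, List.isChain_cons]
    refine ⟨fun c hc => hstep_h.trans (hKc.1 c hc), hKc.2.imp_append_singleton ?_⟩
    intro a ha c hac
    obtain ⟨k, hk, rfl⟩ := List.mem_map.1 ha
    rw [hstep, tourStep, cross_of_not_adj, hac]
    · exact fun hkF => hKW k hk (Dart.extremity_of_edge (s.grown.ends_mem hkF)).1
    · rintro h'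
      obtain rfl := Option.some_injective _ h'
      exact hKW _ hk s.extremity_mem
    · rintro h'
      obtain rfl := Option.some_injective _ h'
      exact hK hk
  · have hc2 := hc.2
    rw [List.isChain_cons] at hc2 ⊢
    refine ⟨fun c hc => hstep_swap.trans (hc2.1 c hc),
      hc2.2.imp_append_singleton fun a ha c hac => ?_⟩
    obtain ⟨k, hk, rfl⟩ := List.mem_map.1 ha
    rw [← hac, hstep]
    · rintro h'
      obtain rfl := Option.some_injective _ h'
      rw [List.nodup_append] at hnd
      exact (List.nodup_cons.1 hnd.2.1).1 hk
    · rintro h'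
      obtain rfl := Option.some_injective _ h'
      exact hW (hPL _ (by simp [hk]))

theorem cross_edge [Finite V] (s : M.TourStage W F A D P (h :: L)) (hD : (Dart.edge h).1 ∉ D)
    (hW : Dart.extremity h.swap ∉ W) :
    ∃ L', M.TourStage (insert (Dart.extremity h.swap) W) (insert (Dart.edge h).1 F)
      (insert (Dart.extremity h.swap, Dart.extremity h) A) (insert (Dart.edge h).1 D)
      (P ++ [h]) L' := by
  have hstar : Dart.extremity h.swap ≠ M.star := fun h' => hW (h' ▸ s.grown.root_mem)
  obtain ⟨K, hK, hKmem, hKc⟩ := M.exists_orbit_list_some hstar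
  rw [List.nodup_cons] at hK
  have hPL : ∀ k ∈ P ++ h :: L, Dart.extremity k ∈ W := fun k hk => (s.mem_iff k).1 hk
  have hnd := s.nodup
  have hperm : (P ++ [h] ++ (K ++ h.swap :: L)).Perm ((P ++ h :: L) ++ (h.swap :: K)) := by
    rw [List.append_assoc, List.append_assoc]
    refine List.Perm.append_left P ?_
    rw [List.singleton_append, List.cons_append, List.perm_cons]
    exact List.perm_middle.trans (((List.perm_append_comm).cons _).trans List.perm_middle.symm)
  refine ⟨K ++ h.swap :: L, ?_, Finset.insert_subset_insert _ s.subset, fun f hf => ?_, ?_, ?_,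
    fun k => ?_, fun k hk => ?_, fun f h1 h2 => ?_, ?_⟩
  · refine s.grown.add s.extremity_mem hW ?_
    rcases h with e | e
    · exact .inr rfl
    · exact .inl rfl
  · rcases Finset.mem_insert.1 hf with rfl | hf
    · exact (Dart.edge h).2
    · exact s.adj f hf
  · exact s.isChain_cross hD hW hK.1 (fun k hk => (hKmem k).1 (List.mem_cons_of_mem _ hk)) hKc
  · rw [hperm.nodup_iff, List.nodup_append]
    refine ⟨hnd, List.nodup_cons.2 hK, ?_⟩
    rintro a ha b hb rfl
    exact hW ((hKmem a).1 hb ▸ hPL a ha)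
  · rw [hperm.mem_iff, List.mem_append, s.mem_iff, hKmem, Finset.mem_insert, or_comm]
  · rcases List.mem_append.1 hk with hk | hk
    · exact Finset.mem_insert_of_mem (s.decided k hk)
    · rw [List.mem_singleton.1 hk]
      exact Finset.mem_insert_self _ _
  · rw [Finset.mem_insert] at h1 h2
    push Not at h2
    obtain ⟨X, Y, rfl, hX⟩ := s.good f (h1.resolve_left h2.1) h2.2
    exact ⟨X, Y ++ [h], by simp, hX⟩
  -- The new vertex is a child of the extremity of `h`, which lies below all pending extremities, so
  -- its darts can precede them.
  · have hmono : ∀ {a b : V}, Relation.ReflTransGen (fun a b => (a, b) ∈ A) a b →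
        Relation.ReflTransGen
          (fun a b => (a, b) ∈ insert (Dart.extremity h.swap, Dart.extremity h) A) a b :=
      fun h => Relation.ReflTransGen.mono (fun _ _ h => Finset.mem_insert_of_mem h) _ _ h
    have hanc := List.pairwise_cons.1 s.ancestors
    have hlow : ∀ l ∈ L, Relation.ReflTransGen
        (fun a b => (a, b) ∈ insert (Dart.extremity h.swap, Dart.extremity h) A)
        (Dart.extremity h.swap) (Dart.extremity l) := fun l hl =>
      (hmono (hanc.1 l hl)).head (Finset.mem_insert_self _ _)
    have hKe : ∀ k ∈ K, Dart.extremity k = Dart.extremity h.swap := fun k hk =>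
      (hKmem k).1 (List.mem_cons_of_mem _ hk)
    refine List.pairwise_append.2 ⟨?_, List.pairwise_cons.2 ⟨hlow, hanc.2.imp hmono⟩, ?_⟩
    · refine List.pairwise_of_forall_mem_list fun a ha b hb => ?_
      rw [hKe a ha, hKe b hb]
    · intro a ha b hb
      rw [hKe a ha]
      rcases List.mem_cons.1 hb with rfl | hb
      · rfl
      · exact hlow b hb

end TourStage

end RootedMap

end Digraph

namespace Digraph

/-! ### The induction along the tour -/

theorem ratVar_injective (K : Type*) [Field K] {V : Type*} :
    Function.Injective (ratVar K : V → FractionRing (MvPolynomial V K)) :=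
  (IsFractionRing.injective (MvPolynomial V K) (FractionRing (MvPolynomial V K))).comp
    (MvPolynomial.X_injective)

/-! ### Effect of an added edge on Ψ -/

section LinearExtensions

variable (K : Type*) [Field K] {V : Type*} [Fintype V] {H : Digraph V} {u v : V}

theorem mem_linearExtensions_sup_ofEdges {w : Fin (Fintype.card V) ≃ V} :
    w ∈ (H ⊔ ofEdges {(u, v)}).linearExtensions ↔
      w ∈ H.linearExtensions ∧ w.symm u ≤ w.symm v := by
  simp only [linearExtensions, Finset.mem_filter, Finset.mem_univ, true_and, sup_adj, ofEdges_adj,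
    Finset.mem_singleton, Prod.mk.injEq]
  constructor
  · exact fun h => ⟨fun a b hab => h a b (.inl hab), h u v (.inr ⟨rfl, rfl⟩)⟩
  · rintro ⟨h, h'⟩ a b (hab | ⟨rfl, rfl⟩)
    · exact h a b hab
    · exact h'

/-- Each total order compares the distinct vertices `u` and `v` in exactly one way. -/
theorem Psi_eq_add (h : u ≠ v) :
    H.Psi K = (H ⊔ ofEdges {(u, v)}).Psi K + (H ⊔ ofEdges {(v, u)}).Psi K := by
  classical
  rw [Psi, Psi, Psi, ← Finset.sum_filter_add_sum_filter_not _ fun w => w.symm u ≤ w.symm v]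
  congr 2
  · ext w
    rw [mem_linearExtensions_sup_ofEdges, Finset.mem_filter]
  · ext w
    rw [mem_linearExtensions_sup_ofEdges, Finset.mem_filter, not_le]
    refine and_congr_right fun _ => ⟨le_of_lt, fun h' => h'.lt_of_ne fun h'' => ?_⟩
    exact h (w.symm.injective h''.symm)

theorem le_of_reflTransGen {w : Fin (Fintype.card V) ≃ V} (hw : w ∈ H.linearExtensions)
    (h : Relation.ReflTransGen H.Adj u v) : w.symm u ≤ w.symm v := by
  simp only [linearExtensions, Finset.mem_filter, Finset.mem_univ, true_and] at hw
  induction h with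
  | refl => rfl
  | tail _ h ih => exact ih.trans (hw _ _ h)

theorem Psi_sup_ofEdges (h : Relation.ReflTransGen H.Adj u v) :
    (H ⊔ ofEdges {(u, v)}).Psi K = H.Psi K := by
  rw [Psi, Psi]
  refine Finset.sum_congr ?_ fun _ _ => rfl
  ext w
  rw [mem_linearExtensions_sup_ofEdges]
  exact and_iff_left_of_imp fun hw => le_of_reflTransGen hw h

theorem Psi_eq_zero_of_cycle (huv : u ≠ v) (h : Relation.ReflTransGen H.Adj u v)
    (h' : Relation.ReflTransGen H.Adj v u) : H.Psi K = 0 := by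
  rw [Psi]
  refine Finset.sum_eq_zero fun w hw => absurd ?_ huv
  exact w.symm.injective ((le_of_reflTransGen hw h).antisymm (le_of_reflTransGen hw h'))

end LinearExtensions

theorem RootedMap.mem_goodTrees {V : Type*} [Fintype V] {G : Digraph V} {M : G.RootedMap}
    {T : Digraph V} : T ∈ M.goodTrees ↔ M.IsGood T := by
  simp [goodTrees]

section Stages

variable {V : Type*} (G : Digraph V)

/-- The edges of `G` that are not in `D`, together with the edges in `A`. -/
def stageGraph (D A : Finset (V × V)) : Digraph V :=
  ⟨fun a b => (G.Adj a b ∧ (a, b) ∉ D) ∨ (a, b) ∈ A⟩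

variable {G} [DecidableEq V] {D A : Finset (V × V)} {e : V × V}

theorem stageGraph_eq_sup (h : G.Adj e.1 e.2) (hD : e ∉ D) :
    G.stageGraph D A = G.stageGraph (insert e D) A ⊔ ofEdges {e} := by
  ext a b
  simp only [stageGraph, sup_adj, ofEdges_adj, Finset.mem_insert, Finset.mem_singleton]
  by_cases hab : (a, b) = e
  · subst hab
    simp [h, hD]
  · simp [hab]

theorem stageGraph_insert : G.stageGraph D (insert e A) = G.stageGraph D A ⊔ ofEdges {e} := by
  ext a b
  simp only [stageGraph, sup_adj, ofEdges_adj, Finset.mem_insert, Finset.mem_singleton]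
  rw [or_comm (a := (a, b) = e), or_assoc]

variable [Fintype V] (K : Type*) [Field K]

open Classical in
/-- The part of the sum over good spanning trees of those that agree with the decisions made. -/
noncomputable def RootedMap.goodTreeSum (M : G.RootedMap) (F D : Finset (V × V)) :
    FractionRing (MvPolynomial V K) :=
  ∑ T ∈ M.goodTrees.filter fun T => ∀ e ∈ D, T.Adj e.1 e.2 ↔ e ∈ F,
    ∏ e ∈ (G \ T).edgeFinset, (ratVar K e.1 - ratVar K e.2)

variable {K} {M : G.RootedMap} {W F : Finset (V × V)}

theorem RootedMap.goodTreeSum_eq_add (he : e ∉ D) (hF : F ⊆ D) :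
    M.goodTreeSum K F D = M.goodTreeSum K F (insert e D) +
      M.goodTreeSum K (insert e F) (insert e D) := by
  classical
  have heF : e ∉ F := fun h => he (hF h)
  rw [goodTreeSum, goodTreeSum, goodTreeSum,
    ← Finset.sum_filter_not_add_sum_filter _ fun T : Digraph V => T.Adj e.1 e.2,
    Finset.filter_filter, Finset.filter_filter]
  congr 2
  · refine Finset.filter_congr fun T _ => ?_
    simp only [Finset.mem_insert, forall_eq_or_imp]
    constructor
    · exact fun h => ⟨iff_of_false h.2 heF, h.1⟩
    · exact fun h => ⟨h.2, mt h.1.1 heF⟩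
  · refine Finset.filter_congr fun T _ => ?_
    simp only [Finset.mem_insert, forall_eq_or_imp, true_or, iff_true]
    rw [and_comm]
    refine and_congr_right fun _ => forall₂_congr fun f hf => ?_
    rw [or_iff_right (ne_of_mem_of_not_mem hf he)]

end Stages

/-! ### Evaluation of the sum over good trees -/

namespace RootedMap.TourStage

variable {V : Type*} [DecidableEq V] {G : Digraph V} {M : G.RootedMap}
  {W : Finset V} {F A D : Finset (V × V)} {P L : List G.Dart}

theorem decided_of_complete (s : M.TourStage W F A D P []) {a b : V} (hab : G.Adj a b)
    (h : a ∈ W ∨ b ∈ W) : (a, b) ∈ D := by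
  have hP : ∀ k : G.Dart, Dart.extremity k ∈ W → (Dart.edge k).1 ∈ D := fun k hk =>
    s.decided k (by simpa using (s.mem_iff k).2 hk)
  rcases h with h | h
  · exact hP (Sum.inl ⟨(a, b), hab⟩) h
  · exact hP (Sum.inr ⟨(a, b), hab⟩) h

variable [Fintype V] {K : Type*} [Field K]

theorem goodTreeSum_eq_zero_of_inr {e : G.Edge} (s : M.TourStage W F A D P (Sum.inr e :: L))
    (he : e.1 ∉ D) : M.goodTreeSum K F (insert e.1 D) = 0 := by
  classical
  rw [goodTreeSum]
  refine Finset.sum_eq_zero fun T hT => ?_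
  rw [Finset.mem_filter, mem_goodTrees] at hT
  refine absurd (hT.1.2 e ?_) (s.not_tourBefore
    (fun f hf => hT.2 f (Finset.mem_insert_of_mem hf)) he)
  rw [hT.2 e.1 (Finset.mem_insert_self _ _)]
  exact fun h => he (s.subset h)

theorem goodTreeSum_eq_zero_of_mem (s : M.TourStage W F A D P L) {e : V × V} (he : e ∉ D)
    (h1 : e.1 ∈ W) (h2 : e.2 ∈ W) : M.goodTreeSum K (insert e F) (insert e D) = 0 := by
  classical
  rw [goodTreeSum]
  refine Finset.sum_eq_zero fun T hT => ?_
  rw [Finset.mem_filter, mem_goodTrees] at hT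
  have hT' : ∀ f ∈ insert e F, T.Adj f.1 f.2 := fun f hf =>
    (hT.2 f (Finset.insert_subset_insert _ s.subset hf)).2 hf
  exact absurd hT.1.1.2 (s.grown.not_isTree (fun f hf => hT' f (Finset.mem_insert_of_mem hf))
    (fun h => he (s.subset h)) (hT' e (Finset.mem_insert_self _ _)) h1 h2)

/-- All edges touching `W` are decided, and those kept stay inside `W`; a compatible spanning tree
could never leave `W`. -/
theorem goodTreeSum_eq_zero_of_complete (s : M.TourStage W F A D P []) (hW : W ≠ Finset.univ) :
    M.goodTreeSum K F D = 0 := by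
  classical
  rw [goodTreeSum]
  refine Finset.sum_eq_zero fun T hT => ?_
  rw [Finset.mem_filter, mem_goodTrees] at hT
  refine absurd (Finset.eq_univ_iff_forall.2 fun a => ?_) hW
  have hF : ∀ a b, T.Adj a b → a ∈ W ∨ b ∈ W → (a, b) ∈ F := fun a b hab h =>
    (hT.2 (a, b) (s.decided_of_complete (hT.1.1.1 hab) h)).1 hab
  have := SimpleGraph.Connected.preconnected hT.1.1.2.1 M.star a
  rw [SimpleGraph.reachable_iff_reflTransGen] at this
  induction this with
  | refl => exact s.grown.root_mem
  | tail _ h ih =>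
    rcases h.2 with h | h
    · exact (s.grown.ends_mem (hF _ _ h (.inl ih))).2
    · exact (s.grown.ends_mem (hF _ _ h (.inr ih))).1

theorem Psi_eq_zero_of_complete (s : M.TourStage W F A D P []) (hW : W ≠ Finset.univ) :
    (G.stageGraph D A).Psi K = 0 := by
  rw [Psi_eq_wordSum, ← Finset.union_compl W]
  refine wordSum_union_eq_zero (ratVar_injective K) ⟨_, s.grown.root_mem⟩ ?_ disjoint_compl_right ?_
  · rwa [Finset.nonempty_iff_ne_empty, ne_eq, Finset.compl_eq_empty_iff]
  · intro a ha b hb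
    rw [Finset.mem_compl] at hb
    refine ⟨?_, ?_⟩
    · rintro (h | h)
      · exact h.2 (s.decided_of_complete h.1 (.inl ha))
      · exact hb (s.grown.oriented_ends_mem h).2
    · rintro (h | h)
      · exact h.2 (s.decided_of_complete h.1 (.inr ha))
      · exact hb (s.grown.oriented_ends_mem h).1

/-- Every edge is decided, so `ofEdges F` is the only candidate; the recorded order of the darts
makes it good. -/
theorem goodTreeSum_of_complete (s : M.TourStage Finset.univ F A D P []) :
    M.goodTreeSum K F D = ∏ e ∈ G.edgeFinset \ F, (ratVar K e.1 - ratVar K e.2) := by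
  classical
  have hF : ∀ {a b}, (a, b) ∈ F → G.Adj a b := fun h => s.adj _ (s.subset h)
  have hD : ∀ {a b}, G.Adj a b → (a, b) ∈ D := fun h =>
    s.decided_of_complete h (.inl (Finset.mem_univ _))
  have hfilter : (M.goodTrees.filter fun T => ∀ e ∈ D, T.Adj e.1 e.2 ↔ e ∈ F) = {ofEdges F} := by
    ext T
    rw [Finset.mem_filter, mem_goodTrees, Finset.mem_singleton]
    constructor
    · rintro ⟨h, hT⟩
      ext a b
      exact ⟨fun hab => (hT (a, b) (hD (h.1.1 hab))).1 hab,
        fun hab => (hT (a, b) (s.subset hab)).2 hab⟩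
    · rintro rfl
      refine ⟨⟨⟨fun a b hab => hF hab, s.grown.isTree⟩, fun e he => ?_⟩, fun e _ => Iff.rfl⟩
      exact s.tourBefore (fun e _ => Iff.rfl) (hD e.2) he
  rw [goodTreeSum, hfilter, Finset.sum_singleton]
  refine Finset.prod_congr ?_ fun _ _ => rfl
  ext e
  rw [mem_edgeFinset, Finset.mem_sdiff, mem_edgeFinset]
  rfl

theorem Psi_mul_prod_of_complete (s : M.TourStage Finset.univ F A D P []) :
    (G.stageGraph D A).Psi K * ∏ e ∈ A, (ratVar K e.1 - ratVar K e.2) = 1 := by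
  have : G.stageGraph D A = ofEdges A := by
    ext a b
    refine or_iff_right fun h => h.2 ?_
    exact s.decided_of_complete h.1 (.inl (Finset.mem_univ _))
  rw [this, Psi_eq_wordSum, s.grown.wordSum_mul_prod (ratVar_injective K)]

variable (K) in
theorem goodTreeSum_eq_of_complete (s : M.TourStage W F A D P []) :
    M.goodTreeSum K F D = (G.stageGraph D A).Psi K * (∏ e ∈ A, (ratVar K e.1 - ratVar K e.2)) *
      ∏ e ∈ G.edgeFinset \ F, (ratVar K e.1 - ratVar K e.2) := by
  by_cases hW : W = Finset.univ
  · subst hW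
    rw [s.goodTreeSum_of_complete, s.Psi_mul_prod_of_complete, one_mul]
  · rw [s.goodTreeSum_eq_zero_of_complete hW, s.Psi_eq_zero_of_complete hW, zero_mul, zero_mul]

theorem prod_sdiff_eq_mul (f : V × V → FractionRing (MvPolynomial V K)) (e : G.Edge)
    (he : e.1 ∉ F) :
    ∏ e ∈ G.edgeFinset \ F, f e = f e.1 * ∏ e ∈ G.edgeFinset \ insert e.1 F, f e := by
  rw [Finset.sdiff_insert, Finset.mul_prod_erase]
  exact Finset.mem_sdiff.2 ⟨mem_edgeFinset.2 e.2, he⟩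

theorem Psi_mul_prod_of_inr {e : G.Edge} (s : M.TourStage W F A D P (Sum.inr e :: L))
    (he : e.1 ∉ D) (heW : e.1.1 ∈ W) :
    (G.stageGraph D A).Psi K *
      ∏ e ∈ G.edgeFinset \ F, (ratVar K e.1 - ratVar K e.2) = 0 := by
  by_cases hne : e.1.1 = e.1.2
  -- A loop does not constrain linear extensions, so here the product vanishes rather than Ψ.
  · rw [prod_sdiff_eq_mul _ e fun h => he (s.subset h), hne, sub_self, zero_mul, mul_zero]
  · rw [Psi_eq_zero_of_cycle K hne, zero_mul]
    · exact .single (.inl ⟨e.2, he⟩)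
    · exact Relation.ReflTransGen.mono (fun _ _ h => Or.inr h) _ _ (s.reflTransGen he heW)

/-- The sum over the good spanning trees that agree with the decisions made at some stage. -/
theorem goodTreeSum_eq (n : ℕ) (s : M.TourStage W F A D P L)
    (hn : Nat.card G.Dart < P.length + n) :
    M.goodTreeSum K F D = (G.stageGraph D A).Psi K * (∏ e ∈ A, (ratVar K e.1 - ratVar K e.2)) *
      ∏ e ∈ G.edgeFinset \ F, (ratVar K e.1 - ratVar K e.2) := by
  induction n generalizing W F A D P L with
  | zero =>
    -- `n` bounds the darts still to be processed; at 0, the repetition-free list `P` would be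
    -- longer than the number of darts.
    have := Fintype.ofFinite G.Dart
    rw [Nat.card_eq_fintype_card] at hn
    exact absurd (s.nodup.of_append_left.length_le_card) (not_le.2 hn)
  | succ n ih =>
    rcases L with _ | ⟨h, L⟩
    · exact s.goodTreeSum_eq_of_complete K
    have hlen : Nat.card G.Dart < (P ++ [h]).length + n := by
      rw [List.length_append, List.length_singleton]
      omega
    by_cases hD : (Dart.edge h).1 ∈ D
    · exact ih (s.skip hD) hlen
    have hF : (Dart.edge h).1 ∉ F := fun h' => hD (s.subset h')
    have hv := s.extremity_mem
    rw [RootedMap.goodTreeSum_eq_add hD s.subset]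
    by_cases hW : Dart.extremity h.swap ∈ W
    · rcases h with e | e
      · rw [Dart.edge_inl] at hD hF ⊢
        -- The edge is implied by a path in `A`, so deleting it leaves Ψ unchanged.
        have hr : Relation.ReflTransGen (G.stageGraph (insert e.1 D) A).Adj e.1.1 e.1.2 :=
          Relation.ReflTransGen.mono (fun _ _ h => Or.inr h) _ _ (s.reflTransGen hD hW)
        rw [s.goodTreeSum_eq_zero_of_mem hD hv hW, add_zero, ih (s.delete hD) hlen,
          stageGraph_eq_sup e.2 hD, Psi_sup_ofEdges K hr]
      · rw [Dart.edge_inr] at hD hF ⊢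
        rw [s.goodTreeSum_eq_zero_of_mem hD hW hv, s.goodTreeSum_eq_zero_of_inr hD,
          mul_right_comm, s.Psi_mul_prod_of_inr hD hW, zero_mul, zero_add]
    · obtain ⟨L', s'⟩ := s.cross_edge hD hW
      have hA : (Dart.extremity h.swap, Dart.extremity h) ∉ A := fun h' =>
        hW (s.grown.oriented_ends_mem h').1
      rw [ih s' hlen, prod_sdiff_eq_mul _ _ hF, Finset.prod_insert hA, stageGraph_insert]
      rcases h with e | e
      · simp only [Dart.edge_inl, Dart.extremity_inl, Dart.extremity_inr, Sum.swap_inl] at hD hF ⊢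
        have hne : e.1.1 ≠ e.1.2 := fun h' => hW (h' ▸ hv : e.1.2 ∈ W)
        -- Deleting gives the stage graph without `e`; keeping gives it with `e` reversed, and x_ω -
        -- x_α supplies the minus sign. The difference is Ψ with `e` itself.
        have hPsi := Psi_eq_add K (H := G.stageGraph (insert e.1 D) A) hne
        rw [ih (s.delete hD) hlen, prod_sdiff_eq_mul _ e hF, stageGraph_eq_sup e.2 hD]
        rw [hPsi]
        ring
      · simp only [Dart.edge_inr, Dart.extremity_inl, Dart.extremity_inr, Sum.swap_inr] at hD hF ⊢
        -- Here `e` already points towards the root, so the stage graph and the total product are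
        -- the same before and after.
        rw [s.goodTreeSum_eq_zero_of_inr hD, zero_add, stageGraph_eq_sup e.2 hD, Prod.mk.eta]
        ring

end RootedMap.TourStage

end Digraph

theorem mainTheorem2 (K : Type*) [Field K] [CharZero K] {V : Type*} [Fintype V]
    (G : Digraph V) :
    (∀ M : G.RootedMap,
      G.numerator K =
        algebraMap (MvPolynomial V K) (FractionRing (MvPolynomial V K))
          (∑ T ∈ M.goodTrees, ∏ e ∈ (G \ T).edgeFinset,
            (MvPolynomial.X e.1 - MvPolynomial.X e.2))) ∧
    (∀ M M' : G.RootedMap,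
      (∑ T ∈ M.goodTrees, ∏ e ∈ (G \ T).edgeFinset,
          (MvPolynomial.X e.1 - MvPolynomial.X e.2 : MvPolynomial V K)) =
        ∑ T ∈ M'.goodTrees, ∏ e ∈ (G \ T).edgeFinset,
          (MvPolynomial.X e.1 - MvPolynomial.X e.2 : MvPolynomial V K)) := by
  classical
  have key : ∀ M : G.RootedMap,
      G.numerator K =
        algebraMap (MvPolynomial V K) (FractionRing (MvPolynomial V K))
          (∑ T ∈ M.goodTrees, ∏ e ∈ (G \ T).edgeFinset,
            (MvPolynomial.X e.1 - MvPolynomial.X e.2)) := by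
    intro M
    obtain ⟨L, s⟩ := M.exists_tourStage
    have h := s.goodTreeSum_eq (K := K) (Nat.card G.Dart + 1) (by simp)
    have hG : G.stageGraph ∅ ∅ = G := by
      ext a b
      simp [Digraph.stageGraph]
    rw [hG, Finset.prod_empty, mul_one, Finset.sdiff_empty, ← Digraph.numerator,
      Digraph.RootedMap.goodTreeSum, Finset.filter_true_of_mem (by simp)] at h
    rw [← h, map_sum]
    refine Finset.sum_congr rfl fun T _ => ?_
    rw [map_prod]
    refine Finset.prod_congr rfl fun e _ => ?_
    rw [map_sub]
    rfl
  exact ⟨key, fun M M' => IsFractionRing.injective (MvPolynomial V K)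
    (FractionRing (MvPolynomial V K)) ((key M).symm.trans (key M'))⟩
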